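/- Let $\mathbb F$ be a field and $n\ge 4$. For an $n\times n$ matrix $A$ over $\mathbb F$ and $S,T\subseteq[n]$ let $A[S,T]$ be the submatrix with rows $S$ and columns $T$, $A[S]=A[S,S]$, and $\overline S=[n]\setminus S$. Call $A$ dense if all its off-diagonal entries are nonzero. A set $X\subseteq[n]$ is a cut of $A$ if $2\le|X|\le n-2$ and both $A[X,\overline X]$ and $A[\overline X,X]$ have rank at most one. $A$ has the rank-one extension property if, for all distinct $i,j,k,\ell$ with $\operatorname{rank}A[\{i,j\},\{k,\ell\}]=1$, there is $S\subseteq[n]$ with $i,j\in S$, $k,\ell\in\overline S$ and $\operatorname{rank}A[S,\overline S]=1$. Two $n\times n$ matrices $A,B$ are principal minor equivalent up to order $k$ if $\det A[S]=\det B[S]$ for all $S\subseteq[n]$ with $|S|\le k$, and principal minor equivalent if this holds for all $S\subseteq[n]$. Say that $A$ has form $(\ast)$ if $$A[\{1,2,3,4\}]=\begin{pmatrix}1&1&1&1\\2&1&1&1\\1&1&1&2\\1&1&1&1\end{pmatrix},$$ all diagonal entries of $A$ are $1$, and $A_{ij}=A_{ji}$ whenever $i\ge5$ or $j\ge5$.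 For such $A$ let $B$ be the matrix obtained from $A$ by exchanging the entries in positions $(1,2)$ and $(2,1)$ and keeping all other entries. (1) If $A$ is dense, has form $(\ast)$, and has no cut $X$ with $\{1,2\}\subseteq X$ and $\{3,4\}\subseteq\overline X$, then $A$ and $B$ are principal minor equivalent up to order $4$ but not principal minor equivalent. (2) Suppose $n\ge5$ and $2\ne0$ in $\mathbb F$. Let $A$ be the matrix whose block $A[\{1,2,3,4\}]$ is as above, with $A_{i-1,i}=A_{i,i-1}=2$ for $5\le i\le n$, $A_{1,n}=A_{n,1}=2$, and all remaining entries equal to $1$; let $B$ be obtained from it as above. Then $A$ and $B$ are dense and $A$ has form $(\ast)$; $\operatorname{rank}A[\{1,2\},\{3,4\}]=1$, but there is no $X\subseteq[n]$ with $\{1,2\}\subseteq X$, $\{3,4\}\subseteq\overline X$ and $\operatorname{rank}A[X,\overline X]=1$, so $A$ does not have the rank-one extension property; $A$ has no cut $X$ with $\{1,2\}\subseteq X$, $\{3,4\}\subseteq\overline X$; and $A$ and $B$ are principal minor equivalent up to order $n-1$ (hence up to order $4$), but not principal minor equivalent. -/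

import Mathlib

namespace PrincipalMinors

variable {F : Type*} [Field F] {n : ℕ}

/-- The submatrix `A[S, T]` with rows indexed by `S` and columns indexed by `T`. -/
def block (A : Matrix (Fin n) (Fin n) F) (S T : Finset (Fin n)) :
    Matrix {x // x ∈ S} {x // x ∈ T} F :=
  A.submatrix Subtype.val Subtype.val

/-- The principal minor `det A[S]`. -/
def principalMinor (A : Matrix (Fin n) (Fin n) F) (S : Finset (Fin n)) : F :=
  (block A S S).det

/-- All corresponding principal minors of order at most `k` are equal. -/
def PMEUpTo (k : ℕ) (A B : Matrix (Fin n) (Fin n) F) : Prop :=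
  ∀ S : Finset (Fin n), S.card ≤ k → principalMinor A S = principalMinor B S

/-- Principal minor equivalence: all corresponding principal minors are equal. -/
def PME (A B : Matrix (Fin n) (Fin n) F) : Prop :=
  ∀ S : Finset (Fin n), principalMinor A S = principalMinor B S

/-- All off-diagonal entries are nonzero. -/
def IsDense (A : Matrix (Fin n) (Fin n) F) : Prop :=
  ∀ i j, i ≠ j → A i j ≠ 0

/-- The rank-one extension property. -/
def HasRankOneExtension (A : Matrix (Fin n) (Fin n) F) : Prop :=
  ∀ i j k l : Fin n, i ≠ j → i ≠ k → i ≠ l → j ≠ k → j ≠ l → k ≠ l →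
    (block A {i, j} {k, l}).rank = 1 →
      ∃ S : Finset (Fin n), i ∈ S ∧ j ∈ S ∧ k ∈ Sᶜ ∧ l ∈ Sᶜ ∧ (block A S Sᶜ).rank = 1

/-- `X` is a cut of `A`. -/
def IsCut (A : Matrix (Fin n) (Fin n) F) (X : Finset (Fin n)) : Prop :=
  2 ≤ X.card ∧ X.card + 2 ≤ n ∧ (block A X Xᶜ).rank ≤ 1 ∧ (block A Xᶜ X).rank ≤ 1

/-- The indices `1, 2, 3, 4` of `[n]`, numbered from zero. -/
def idx (hn : 4 ≤ n) (k : Fin 4) : Fin n := Fin.castLE hn k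

variable (F) in
/-- The prescribed leading `4 × 4` block. -/
def leadingBlock : Matrix (Fin 4) (Fin 4) F :=
  !![1, 1, 1, 1;
     2, 1, 1, 1;
     1, 1, 1, 2;
     1, 1, 1, 1]

/-- `A` has the prescribed leading `4 × 4` block, all its diagonal entries are `1`, and it is
symmetric outside the leading block. -/
def HasTemplateForm (hn : 4 ≤ n) (A : Matrix (Fin n) (Fin n) F) : Prop :=
  (∀ p q : Fin 4, A (idx hn p) (idx hn q) = leadingBlock F p q) ∧
  (∀ i, A i i = 1) ∧
  (∀ i j : Fin n, 4 ≤ (i : ℕ) ∨ 4 ≤ (j : ℕ) → A i j = A j i)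

/-- The matrix obtained from `A` by exchanging the entries in the positions `(1, 2)` and `(2, 1)`
and leaving all other entries unchanged. -/
def swapEntries (hn : 4 ≤ n) (A : Matrix (Fin n) (Fin n) F) : Matrix (Fin n) (Fin n) F :=
  Matrix.of fun i j =>
    if (i = idx hn 0 ∧ j = idx hn 1) ∨ (i = idx hn 1 ∧ j = idx hn 0) then A j i else A i j

variable (F n) in
/-- The explicit matrix: the prescribed leading `4 × 4` block; outside it the entry is `2` in the
positions `(i - 1, i)`, `(i, i - 1)` for `5 ≤ i ≤ n` and `(1, n)`, `(n, 1)` (one-based), and `1`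
in all other positions. -/
def explicitMatrix : Matrix (Fin n) (Fin n) F :=
  Matrix.of fun i j =>
    if h : (i : ℕ) < 4 ∧ (j : ℕ) < 4 then leadingBlock F ⟨i, h.1⟩ ⟨j, h.2⟩
    else if (i : ℕ) + 1 = j ∨ (j : ℕ) + 1 = i ∨
        ((i : ℕ) = 0 ∧ (j : ℕ) + 1 = n) ∨ ((j : ℕ) = 0 ∧ (i : ℕ) + 1 = n) then 2
    else 1

end PrincipalMinors

open PrincipalMinors

/-!
Exchanging `A a b` and `A b a` in a matrix which is symmetric apart from the positions `(a, b)`,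
`(b, a)`, `(c, d)`, `(d, c)` changes its determinant by `(A b a - A a b) * (A c d - A d c)` times
the minor with the rows `c`, `d` and the columns `a`, `b` deleted. This is Kronecker's relation
between the minors of a symmetric matrix. Applied to `A[S]`, it reduces principal minor equivalence
to the vanishing of such a minor for every `S` containing `a`, `b`, `c`, `d`.

Consider the digraph whose edges `s → t` are the nonzero `2 × 2` minors of `A` with the rows `a`,
`s` and the columns `c`, `t`. A path from `b` to `d` without shortcuts, together with `a` and `c`,
gives a set `S` for which the minor does not vanish. If there is no path, the vertices reachable
from `b`, together with `a`, form a cut of `A`; conversely a cut separating `a`, `b` from `c`, `d`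
makes all the minors vanish. For the explicit matrix every path from `b = 2` to `d = 4` passes
through all of `n, n - 1, …, 5`, so that the principal minors on `S` agree unless `S = [n]`.
-/

namespace PrincipalMinors

open Matrix

section Determinants

open Polynomial nonZeroDivisors

variable {ι R : Type*} [DecidableEq ι] [CommRing R]

/-- The matrix obtained from `A` by exchanging the entries in the positions `(a, b)` and
`(b, a)`. -/
def exchange (A : Matrix ι ι R) (a b : ι) : Matrix ι ι R :=
  of fun i j => if (i = a ∧ j = b) ∨ (i = b ∧ j = a) then A j i else A i j

/-- `A` is symmetric except possibly at the pairs of positions `(a, b)`, `(b, a)` and `(c, d)`,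
`(d, c)`. -/
def IsSymmExcept (A : Matrix ι ι R) (a b c d : ι) : Prop :=
  ∀ i j, s(i, j) ≠ s(a, b) → s(i, j) ≠ s(c, d) → A i j = A j i

variable [Fintype ι]

/-- The minor of `A` of codimension two with the rows `i`, `j` and the columns `k`, `l` deleted,
with the sign it has as the coefficient of `A i k * A j l` in `det A`. -/
def coMinor (A : Matrix ι ι R) (i j k l : ι) : R :=
  ((A.updateRow i (Pi.single k 1)).updateRow j (Pi.single l 1)).det

theorem map_coMinor {S : Type*} [CommRing S] (f : R →+* S) (A : Matrix ι ι R) (i j k l : ι) :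
    f (coMinor A i j k l) = coMinor (A.map f) i j k l := by
  have map_single (k : ι) : f ∘ Pi.single k 1 = Pi.single k 1 := by
    ext t
    simp [Pi.single_apply, apply_ite f]
  simp only [coMinor, RingHom.map_det, RingHom.mapMatrix_apply, map_updateRow, map_single]

theorem det_updateRow_updateRow_of_isUnit {A : Matrix ι ι R} (hA : IsUnit A.det) {i j : ι}
    (hij : i ≠ j) (u v : ι → R) :
    ((A.updateRow i u).updateRow j v).det =
      A.det * ((u ᵥ* A⁻¹) i * (v ᵥ* A⁻¹) j - (u ᵥ* A⁻¹) j * (v ᵥ* A⁻¹) i) := by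
  let U : Matrix ι (Fin 2) R := (of ![Pi.single i 1, Pi.single j 1])ᵀ
  let V : Matrix (Fin 2) ι R := of ![u - A i, v - A j]
  have hUV : (A.updateRow i u).updateRow j v = A + U * V := by
    ext s t
    rcases eq_or_ne s j with rfl | hj
    · simp [U, V, mul_apply, hij.symm]
    · rcases eq_or_ne s i with rfl | hi <;> simp [U, V, mul_apply, *]
  have row_vecMul (s : ι) : A s ᵥ* A⁻¹ = Pi.single s 1 := by
    ext t
    rw [← one_eq_pi_single, ← mul_nonsing_inv A hA, mul_apply_eq_vecMul]
  have hentry (p q : Fin 2) :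
      (V * A⁻¹ * U) p q = (V p ᵥ* A⁻¹) (![i, j] q) := by
    rw [mul_apply_eq_vecMul, mul_apply_eq_vecMul]
    fin_cases q <;> simp [U, vecMul]
  have hV₀ : V 0 ᵥ* A⁻¹ = u ᵥ* A⁻¹ - Pi.single i 1 := by
    rw [← row_vecMul, ← sub_vecMul]
    rfl
  have hV₁ : V 1 ᵥ* A⁻¹ = v ᵥ* A⁻¹ - Pi.single j 1 := by
    rw [← row_vecMul, ← sub_vecMul]
    rfl
  rw [hUV, det_add_mul _ _ hA, det_fin_two]
  simp only [Matrix.add_apply, hentry, hV₀, hV₁]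
  simp [hij, hij.symm]

theorem coMinor_sub_coMinor_of_isUnit {A : Matrix ι ι R} (hA : IsUnit A.det) (hsymm : A.IsSymm)
    {a b c d : ι} (hac : a ≠ c) (hbc : b ≠ c) (hcd : c ≠ d) :
    coMinor A a c b d - coMinor A b c a d = coMinor A c d a b := by
  have hinv (i j : ι) : A⁻¹ i j = A⁻¹ j i := by
    rw [← transpose_apply A⁻¹, transpose_nonsing_inv, hsymm]
  simp only [coMinor, det_updateRow_updateRow_of_isUnit hA, hac, hbc, hcd, ne_eq, not_false_eq_true,
    single_one_vecMul, row]
  rw [hinv a b, hinv b d, hinv a d]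
  ring

/-- Kronecker's relation between the minors of a symmetric matrix. -/
theorem coMinor_sub_coMinor {A : Matrix ι ι R} (hsymm : A.IsSymm)
    {a b c d : ι} (hac : a ≠ c) (hbc : b ≠ c) (hcd : c ≠ d) :
    coMinor A a c b d - coMinor A b c a d = coMinor A c d a b := by
  -- The matrix `A + X` is invertible over the total ring of fractions of `R[X]`.
  let P : Matrix ι ι R[X] := charmatrix (-A)
  let f := algebraMap R[X] (FractionRing R[X])
  have hP : P.IsSymm := by rw [IsSymm, ← charmatrix_transpose, transpose_neg, hsymm]
  have hdet : IsUnit (P.map f).det := by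
    rw [← RingHom.mapMatrix_apply, ← RingHom.map_det]
    exact IsLocalization.map_units _
      (⟨P.det, (charpoly_monic (-A)).mem_nonZeroDivisors⟩ : R[X]⁰)
  have hX : coMinor P a c b d - coMinor P b c a d = coMinor P c d a b := by
    apply IsFractionRing.injective R[X] (FractionRing R[X])
    simpa only [map_sub, map_coMinor] using
      coMinor_sub_coMinor_of_isUnit hdet (hP.map f) hac hbc hcd
  have heval : P.map (evalRingHom 0) = A := by
    ext i j
    by_cases h : i = j <;> simp [P, h]
  simpa only [map_sub, map_coMinor, heval] using congrArg (evalRingHom 0) hX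

omit [Fintype ι] in
theorem add_single_eq_updateRow (A : Matrix ι ι R) (i j : ι) (x : R) :
    A + single i j x = A.updateRow i (A i + x • Pi.single j 1) := by
  ext s t
  rcases eq_or_ne s i with rfl | h
  · simp [single_apply, Pi.single_apply, eq_comm]
  · simp [h, h.symm]

theorem det_add_single (A : Matrix ι ι R) (i k : ι) (x : R) :
    (A + single i k x).det = A.det + x * A.adjugate k i := by
  rw [add_single_eq_updateRow, det_updateRow_add, det_updateRow_smul, updateRow_eq_self,
    adjugate_apply]

theorem adjugate_add_single (A : Matrix ι ι R) {i j : ι} (hij : i ≠ j) (k l : ι) (x : R) :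
    (A + single i k x).adjugate l j = A.adjugate l j + x * coMinor A i j k l := by
  have hi : (A.updateRow j (Pi.single l 1)).updateRow i (A i) = A.updateRow j (Pi.single l 1) := by
    rw [updateRow_comm _ hij.symm, updateRow_eq_self]
  rw [adjugate_apply, adjugate_apply, coMinor, add_single_eq_updateRow, updateRow_comm _ hij,
    det_updateRow_add, det_updateRow_smul, hi, updateRow_comm _ hij]

theorem det_add_single_add_single (A : Matrix ι ι R) {i j : ι} (hij : i ≠ j) (k l : ι) (x y : R) :
    (A + single i k x + single j l y).det =
      A.det + x * A.adjugate k i + y * A.adjugate l j + x * y * coMinor A i j k l := by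
  rw [det_add_single, det_add_single, adjugate_add_single _ hij]
  ring

theorem coMinor_add_single_add_single (A : Matrix ι ι R) {a b c d : ι} (hbc : b ≠ c) (hbd : b ≠ d)
    (hcd : c ≠ d) (x y : R) :
    coMinor (A + single b a x + single c d y) c d a b = coMinor A c d a b := by
  let N := (A.updateRow c (Pi.single a 1)).updateRow d (Pi.single b 1)
  have hN : ((A + single b a x + single c d y).updateRow c (Pi.single a 1)).updateRow d
      (Pi.single b 1) = N.updateRow b (N b + x • N c) := by
    ext s t
    rcases eq_or_ne s d with rfl | hsd
    · simp [N, hbd.symm]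
    rcases eq_or_ne s c with rfl | hsc
    · simp [N, hbc.symm, hcd]
    rcases eq_or_ne s b with rfl | hsb
    · simp [N, hsd, hsc, hsc.symm, hcd, single_apply, Pi.single_apply, eq_comm]
    · simp [N, hsd, hsc, hsc.symm, hsb, hsb.symm]
  rw [coMinor, hN, det_updateRow_add_smul_self _ hbc]
  rfl

theorem det_add_single_sub_det_add_single {M : Matrix ι ι R} (hM : M.IsSymm) {a b c d : ι}
    (hac : a ≠ c) (hbc : b ≠ c) (hcd : c ≠ d) (x y : R) :
    (M + single a b x + single c d y).det - (M + single b a x + single c d y).det =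
      x * y * coMinor M c d a b := by
  have hadj : M.adjugate b a = M.adjugate a b := by
    rw [← transpose_apply M.adjugate, adjugate_transpose, hM]
  rw [det_add_single_add_single _ hac, det_add_single_add_single _ hbc,
    ← coMinor_sub_coMinor hM hac hbc hcd, hadj]
  ring

theorem det_exchange {A : Matrix ι ι R} {a b c d : ι} (hA : IsSymmExcept A a b c d)
    (hac : a ≠ c) (hbc : b ≠ c) (hbd : b ≠ d) (hcd : c ≠ d) :
    (exchange A a b).det =
      A.det + (A b a - A a b) * (A c d - A d c) * coMinor A c d a b := by
  let x := A b a - A a b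
  let y := A c d - A d c
  let M := A - single b a x - single c d y
  have hAM : M + single b a x + single c d y = A := by
    simp only [M]
    abel
  have hBM : M + single a b x + single c d y = exchange A a b := by
    ext i j
    simp only [exchange, of_apply, M, Matrix.sub_apply, Matrix.add_apply, single_apply, x, y]
    grind
  have hM : M.IsSymm := by
    ext i j
    have := hA i j
    simp only [ne_eq, Sym2.eq_iff] at this
    simp only [transpose_apply, M, Matrix.sub_apply, single_apply, x, y]
    grind
  have hco : coMinor A c d a b = coMinor M c d a b := by
    rw [← hAM, coMinor_add_single_add_single _ hbc hbd hcd]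
  rw [← sub_eq_iff_eq_add', hco, ← det_add_single_sub_det_add_single hM hac hbc hcd, hAM, hBM]

end Determinants

section PrincipalSubmatrices

variable {ι R : Type*} [DecidableEq ι] [CommRing R] {A : Matrix ι ι R} {S : Finset ι}

/-- The matrix which agrees with `A` on `S × S` and with the identity matrix elsewhere. Its
determinant is the principal minor `det A[S]`, and it allows one to work with minors of `A[S]`
without changing the index type. -/
def principalPad (A : Matrix ι ι R) (S : Finset ι) : Matrix ι ι R :=
  of fun i j => if i ∈ S ∧ j ∈ S then A i j else (1 : Matrix ι ι R) i j

theorem principalPad_of_mem {i j : ι} (hi : i ∈ S) (hj : j ∈ S) :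
    principalPad A S i j = A i j := by
  simp [principalPad, hi, hj]

theorem principalPad_of_ne {i j : ι} (hij : i ≠ j) (h : ¬ (i ∈ S ∧ j ∈ S)) :
    principalPad A S i j = 0 := by
  simp [principalPad, h, hij]

theorem principalPad_row_of_notMem {i : ι} (hi : i ∉ S) : principalPad A S i = Pi.single i 1 := by
  ext j
  simp [principalPad, hi, one_eq_pi_single]

theorem exchange_principalPad (A : Matrix ι ι R) (S : Finset ι) (a b : ι) :
    exchange (principalPad A S) a b = principalPad (exchange A a b) S := by
  ext i j
  simp only [exchange, principalPad, of_apply, one_apply]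
  grind

theorem IsSymmExcept.principalPad {a b c d : ι} (hA : IsSymmExcept A a b c d) (S : Finset ι) :
    IsSymmExcept (principalPad A S) a b c d := by
  intro i j hab hcd
  simp only [PrincipalMinors.principalPad, of_apply, hA i j hab hcd, and_comm, one_apply, eq_comm]

variable [Fintype ι]

theorem det_principalPad (A : Matrix ι ι R) (S : Finset ι) :
    (principalPad A S).det = (A.submatrix ((↑) : S → ι) (↑)).det := by
  have hmem : (principalPad A S).toSquareBlockProp (· ∈ S) = A.submatrix (↑) (↑) := by
    ext i j
    exact principalPad_of_mem i.2 j.2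
  have hcompl : (principalPad A S).toSquareBlockProp (fun i => ¬ i ∈ S) = 1 := by
    ext i j
    simp [toSquareBlockProp, principalPad, i.2, one_apply, Subtype.ext_iff]
  have hzero (i : ι) (hi : i ∉ S) (j : ι) (hj : j ∈ S) : principalPad A S i j = 0 :=
    principalPad_of_ne (fun h => hi (h ▸ hj)) fun h => hi h.1
  rw [twoBlockTriangular_det _ (· ∈ S) hzero, hcompl, det_one, mul_one, hmem]
  congr!

theorem det_submatrix_exchange {a b c d : ι} (hA : IsSymmExcept A a b c d) (hac : a ≠ c)
    (hbc : b ≠ c) (hbd : b ≠ d) (hcd : c ≠ d) (S : Finset ι) :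
    ((exchange A a b).submatrix ((↑) : S → ι) (↑)).det =
      (A.submatrix ((↑) : S → ι) (↑)).det +
        (principalPad A S b a - principalPad A S a b) *
          (principalPad A S c d - principalPad A S d c) * coMinor (principalPad A S) c d a b := by
  rw [← det_principalPad, ← det_principalPad, ← exchange_principalPad,
    det_exchange (hA.principalPad S) hac hbc hbd hcd]

end PrincipalSubmatrices

section Paths

variable {α : Type*} [DecidableEq α] {r : α → α → Prop}

/-- `IsInducedPath r x z S`: the set `S` is the vertex set of a directed path of `r` from `x` to
`z` without forward shortcuts, that is, from each vertex there is no `r`-step to a later vertex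
other than the next one. -/
inductive IsInducedPath (r : α → α → Prop) : α → α → Finset α → Prop
  | refl (x : α) : IsInducedPath r x x {x}
  | cons {x y z : α} {S : Finset α} (hxy : r x y) (hS : IsInducedPath r y z S) (hx : x ∉ S)
      (hskip : ∀ w ∈ S, r x w → w = y) : IsInducedPath r x z (insert x S)

namespace IsInducedPath

variable {x y z : α} {S : Finset α}

theorem start_mem (h : IsInducedPath r x z S) : x ∈ S := by
  cases h <;> simp

theorem end_mem (h : IsInducedPath r x z S) : z ∈ S := by
  induction h with
  | refl => simp
  | cons _ _ _ _ ih => exact Finset.mem_insert_of_mem ih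

theorem eq_start_or_exists_rel (h : IsInducedPath r x z S) {w : α} (hw : w ∈ S) :
    w = x ∨ ∃ s, r s w := by
  induction h with
  | refl => exact .inl (Finset.mem_singleton.mp hw)
  | cons hxy _ _ _ ih =>
    rcases Finset.mem_insert.mp hw with rfl | hw
    · exact .inl rfl
    · rcases ih hw with rfl | h
      exacts [.inr ⟨_, hxy⟩, .inr h]

theorem exists_of_mem (h : IsInducedPath r y z S) (hx : x ∈ S) :
    ∃ T, IsInducedPath r x z T := by
  induction h with
  | refl y => exact ⟨{y}, by simpa [Finset.mem_singleton.mp hx] using .refl y⟩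
  | cons hxy hS hy hskip ih =>
    rcases Finset.mem_insert.mp hx with rfl | hx
    exacts [⟨_, .cons hxy hS hy hskip⟩, ih hx]

theorem exists_of_rel (h : IsInducedPath r y z S) {w : α} (hw : w ∈ S) (hxw : r x w) :
    ∃ T, IsInducedPath r x z T := by
  by_cases hx : x ∈ S
  · exact h.exists_of_mem hx
  induction h generalizing w with
  | refl y =>
    obtain rfl := Finset.mem_singleton.mp hw
    exact ⟨_, .cons hxw (.refl w) hx fun v hv _ => Finset.mem_singleton.mp hv⟩
  | @cons y y' z S hyy' hS hy hskip ih =>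
    by_cases hlater : ∃ v ∈ S, r x v
    · obtain ⟨v, hv, hxv⟩ := hlater
      exact ih hv hxv fun hxS => hx (Finset.mem_insert_of_mem hxS)
    · have hnext {v : α} (hv : v ∈ insert y S) (hxv : r x v) : v = y :=
        (Finset.mem_insert.mp hv).resolve_right fun hvS => hlater ⟨v, hvS, hxv⟩
      exact ⟨_, .cons (hnext hw hxw ▸ hxw) (.cons hyy' hS hy hskip) hx fun v => hnext⟩

theorem exists_of_reflTransGen (h : Relation.ReflTransGen r x z) :
    ∃ S, IsInducedPath r x z S := by
  induction h using Relation.ReflTransGen.head_induction_on with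
  | refl => exact ⟨{z}, .refl z⟩
  | head hxy _ ih =>
    obtain ⟨S, hS⟩ := ih
    exact hS.exists_of_rel hS.start_mem hxy

theorem eq_zero_of_mulVec_eq_zero {R : Type*} [CommRing R] [IsDomain R] [Fintype α]
    {M : Matrix α α R} (h : IsInducedPath (fun s t => M s t ≠ 0) x z S) {v : α → R}
    (hv : ∀ s ∈ S, s ≠ z → (M *ᵥ v) s = 0) (hout : ∀ s, ∀ t ∉ S, M s t * v t = 0)
    (hx : v x = 0) : ∀ t ∈ S, v t = 0 := by
  induction h with
  | refl x => simpa using hx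
  | @cons x y z S hxy hS hxS hskip ih =>
    have hz : x ≠ z := fun h => hxS (h ▸ hS.end_mem)
    have hy : v y = 0 := by
      have hrow := hv x (Finset.mem_insert_self x S) hz
      rw [mulVec, dotProduct, Finset.sum_eq_single y] at hrow
      · exact (mul_eq_zero.mp hrow).resolve_left hxy
      · intro t _ hty
        rcases eq_or_ne t x with rfl | htx
        · rw [hx, mul_zero]
        by_cases ht : t ∈ S
        · rw [not_not.mp (mt (hskip t ht) hty), zero_mul]
        · exact hout x t (by simp [htx, ht])
      · simp
    have hS0 : ∀ t ∈ S, v t = 0 := by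
      refine ih (fun s hs => hv s (Finset.mem_insert_of_mem hs)) (fun s t ht => ?_) hy
      rcases eq_or_ne t x with rfl | htx
      · rw [hx, mul_zero]
      · exact hout s t (by simp [htx, ht])
    simpa [hx] using hS0

end IsInducedPath

end Paths

section Condensation

variable {ι R : Type*} [CommRing R]

/-- The `2 × 2` minors `A a c * A s t - A s c * A a t` of `A` containing the pivot in the position
`(a, c)`, as in Chio's condensation. -/
def condensation (A : Matrix ι ι R) (a c : ι) : Matrix ι ι R :=
  of fun s t => A a c * A s t - A s c * A a t

theorem condensation_pivot_row (A : Matrix ι ι R) (a c t : ι) : condensation A a c a t = 0 := by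
  simp [condensation]

theorem condensation_pivot_column (A : Matrix ι ι R) (a c s : ι) :
    condensation A a c s c = 0 := by
  simp [condensation, mul_comm]

variable [Fintype ι]

theorem condensation_mulVec (A : Matrix ι ι R) (a c s : ι) (v : ι → R) :
    (condensation A a c *ᵥ v) s = A a c * (A *ᵥ v) s - A s c * (A *ᵥ v) a := by
  simp only [mulVec, dotProduct, condensation, of_apply, Finset.mul_sum, ← Finset.sum_sub_distrib]
  exact Finset.sum_congr rfl fun t _ => by ring

variable [IsDomain R] [DecidableEq ι] {A : Matrix ι ι R} {a b c d : ι}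

theorem coMinor_eq_zero_of_condensation_eq_zero {X : Finset ι} (ha : a ∈ X) (hb : b ∈ X)
    (hc : c ∉ X) (hd : d ∉ X) (hcd : c ≠ d) (hpivot : A a c ≠ 0)
    (hX : ∀ s ∈ X, ∀ t ∉ X, condensation A a c s t = 0) : coMinor A c d a b = 0 := by
  let N : Matrix ι ι R := of fun s =>
    if s ∈ X then Pi.single s 1 else if s = c then A a else if s = d then 0 else A s
  have hN : N.det = 0 := det_eq_zero_of_row_eq_zero d fun t => by simp [N, hd, hcd.symm]
  obtain ⟨w, hw0, hw⟩ := exists_mulVec_eq_zero_iff.mpr hN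
  have hwX {s : ι} (hs : s ∈ X) : w s = 0 := by
    simpa [N, mulVec, hs] using congrFun hw s
  have hwa : (A *ᵥ w) a = 0 := by
    simpa [N, mulVec, hc] using congrFun hw c
  have hwA {s : ι} (hsc : s ≠ c) (hsd : s ≠ d) : (A *ᵥ w) s = 0 := by
    by_cases hs : s ∈ X
    · have hcond : (condensation A a c *ᵥ w) s = 0 :=
        Finset.sum_eq_zero fun t _ => by
          by_cases ht : t ∈ X
          · rw [hwX ht, mul_zero]
          · exact mul_eq_zero_of_left (hX s hs t ht) _
      simpa [condensation_mulVec, hwa, hpivot] using hcond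
    · simpa [N, mulVec, hs, hsc, hsd] using congrFun hw s
  refine exists_mulVec_eq_zero_iff.mp ⟨w, hw0, funext fun s => ?_⟩
  rcases eq_or_ne s d with rfl | hsd
  · simp [mulVec, hwX hb]
  rcases eq_or_ne s c with rfl | hsc
  · simp [mulVec, hsd, hwX ha]
  · simpa [mulVec, hsd, hsc] using hwA hsc hsd

theorem eq_zero_of_isInducedPath_condensation {S : Finset ι}
    (hS : IsInducedPath (fun s t => condensation A a c s t ≠ 0) b d S) (had : a ≠ d)
    (hpivot : A a c ≠ 0) {v : ι → R} (hva : v a = 0) (hvb : v b = 0)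
    (hout : ∀ t ∉ insert a (insert c S), v t = 0)
    (hv : ∀ s ∈ insert a S, s ≠ d → (A *ᵥ v) s = 0) : v = 0 := by
  have hrow : (A *ᵥ v) a = 0 := hv a (Finset.mem_insert_self a S) had
  have hvt {t : ι} (ht : t ∉ S) (htc : t ≠ c) : v t = 0 := by
    rcases eq_or_ne t a with rfl | hta
    exacts [hva, hout t (by simp [ht, htc, hta])]
  have hvS : ∀ t ∈ S, v t = 0 := by
    refine hS.eq_zero_of_mulVec_eq_zero (fun s hs hsd => ?_) (fun s t ht => ?_) hvb
    · rw [condensation_mulVec, hrow, hv s (Finset.mem_insert_of_mem hs) hsd, mul_zero, mul_zero,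
        sub_zero]
    · rcases eq_or_ne t c with rfl | htc
      · rw [condensation_pivot_column, zero_mul]
      · rw [hvt ht htc, mul_zero]
  have hv_off {t : ι} (htc : t ≠ c) : v t = 0 := by
    by_cases ht : t ∈ S
    exacts [hvS t ht, hvt ht htc]
  have hvc : v c = 0 := by
    rw [mulVec, dotProduct, Finset.sum_eq_single c (fun t _ htc => by rw [hv_off htc, mul_zero])
      (by simp)] at hrow
    exact (mul_eq_zero.mp hrow).resolve_left hpivot
  ext t
  rcases eq_or_ne t c with rfl | htc
  exacts [hvc, hv_off htc]

theorem coMinor_principalPad_ne_zero {S : Finset ι}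
    (hS : IsInducedPath (fun s t => condensation A a c s t ≠ 0) b d S) (hac : a ≠ c) (had : a ≠ d)
    (hbc : b ≠ c) (hpivot : A a c ≠ 0) :
    coMinor (principalPad A (insert a (insert c S))) c d a b ≠ 0 := by
  set T := insert a (insert c S) with hT
  have hcS : c ∉ S := fun hc => by
    obtain hcb | ⟨s, hs⟩ := hS.eq_start_or_exists_rel hc
    exacts [hbc hcb.symm, hs (condensation_pivot_column A a c s)]
  have hcd : c ≠ d := fun h => hcS (h ▸ hS.end_mem)
  intro h0
  obtain ⟨v, hv0, hv⟩ := exists_mulVec_eq_zero_iff.mpr h0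
  have hout (t : ι) (ht : t ∉ T) : v t = 0 := by
    have htc : t ≠ c := fun h => ht (by simp [hT, h])
    have htd : t ≠ d := fun h => ht (by simp [hT, h, hS.end_mem])
    simpa [mulVec, htc, htd, principalPad_row_of_notMem ht] using congrFun hv t
  have hpad {s : ι} (hs : s ∈ T) : (principalPad A T *ᵥ v) s = (A *ᵥ v) s :=
    Finset.sum_congr rfl fun t _ => by
      by_cases ht : t ∈ T
      · exact congrArg (· * v t) (principalPad_of_mem hs ht)
      · rw [hout t ht, mul_zero, mul_zero]
  refine hv0 (eq_zero_of_isInducedPath_condensation hS had hpivot ?_ ?_ hout fun s hs hsd => ?_)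
  · simpa [mulVec, hcd] using congrFun hv c
  · simpa [mulVec] using congrFun hv d
  · have hsc : s ≠ c := by
      rintro rfl
      simp [hac.symm, hcS] at hs
    have hsT : s ∈ T := Finset.insert_subset_insert a (Finset.subset_insert c S) hs
    rw [← hpad hsT]
    simpa [mulVec, hsc, hsd] using congrFun hv s

end Condensation

section Separation

variable {ι R : Type*} [DecidableEq ι] [Finite ι] [CommRing R] {A : Matrix ι ι R} {a b c d : ι}

theorem det_submatrix_exchange_of_not_subset (hA : IsSymmExcept A a b c d) (hac : a ≠ c)
    (hbc : b ≠ c) (hbd : b ≠ d) (hcd : c ≠ d) {S : Finset ι} (hS : ¬ {a, b, c, d} ⊆ S) :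
    ((exchange A a b).submatrix ((↑) : S → ι) (↑)).det =
      (A.submatrix ((↑) : S → ι) (↑)).det := by
  cases nonempty_fintype ι
  have hpad {i j : ι} (h : ¬ (i ∈ S ∧ j ∈ S)) :
      principalPad A S i j - principalPad A S j i = 0 := by
    simp [principalPad, h, mt And.symm h, one_apply, eq_comm]
  rw [det_submatrix_exchange hA hac hbc hbd hcd, add_eq_left]
  by_cases hab : b ∈ S ∧ a ∈ S
  · have hcd' : ¬ (c ∈ S ∧ d ∈ S) := fun h => hS (by
      simp [Finset.insert_subset_iff, hab, h])
    rw [hpad hcd', mul_zero, zero_mul]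
  · rw [hpad hab, zero_mul, zero_mul]

theorem det_submatrix_exchange_of_condensation_eq_zero [IsDomain R] (hA : IsSymmExcept A a b c d)
    (hcd : c ≠ d) (hpivot : A a c ≠ 0) {S X : Finset ι} (ha : a ∈ X) (hb : b ∈ X) (hc : c ∉ X)
    (hd : d ∉ X) (hX : ∀ s ∈ S, s ∈ X → ∀ t ∈ S, t ∉ X → condensation A a c s t = 0) :
    ((exchange A a b).submatrix ((↑) : S → ι) (↑)).det =
      (A.submatrix ((↑) : S → ι) (↑)).det := by
  cases nonempty_fintype ι
  have hne {s t : ι} (hs : s ∈ X) (ht : t ∉ X) : s ≠ t := fun h => ht (h ▸ hs)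
  by_cases hS : {a, b, c, d} ⊆ S
  · obtain ⟨haS, -, hcS, -⟩ : a ∈ S ∧ b ∈ S ∧ c ∈ S ∧ d ∈ S := by
      simpa [Finset.insert_subset_iff] using hS
    have hpad (s : ι) (hs : s ∈ X) (t : ι) (ht : t ∉ X) :
        condensation (principalPad A S) a c s t = 0 := by
      simp only [condensation, of_apply, principalPad_of_mem haS hcS]
      by_cases hsS : s ∈ S
      · by_cases htS : t ∈ S
        · rw [principalPad_of_mem hsS htS, principalPad_of_mem hsS hcS, principalPad_of_mem haS htS]
          exact hX s hsS hs t htS ht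
        · rw [principalPad_of_ne (hne hs ht) (by simp [htS]),
            principalPad_of_ne (hne ha ht) (by simp [htS]), mul_zero, mul_zero, sub_zero]
      · rw [principalPad_of_ne (hne hs ht) (by simp [hsS]),
          principalPad_of_ne (hne hs hc) (by simp [hsS]), mul_zero, zero_mul, sub_zero]
    rw [det_submatrix_exchange hA (hne ha hc) (hne hb hc) (hne hb hd) hcd,
      coMinor_eq_zero_of_condensation_eq_zero ha hb hc hd hcd _ hpad, mul_zero, add_zero]
    rwa [principalPad_of_mem haS hcS]
  · exact det_submatrix_exchange_of_not_subset hA (hne ha hc) (hne hb hc) (hne hb hd) hcd hS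

theorem exists_det_submatrix_exchange_ne [IsDomain R] (hA : IsSymmExcept A a b c d)
    (hac : a ≠ c) (had : a ≠ d) (hbc : b ≠ c) (hbd : b ≠ d) (hpivot : A a c ≠ 0)
    (hab : A a b ≠ A b a) (hcd : A c d ≠ A d c)
    (h : Relation.ReflTransGen (fun s t => condensation A a c s t ≠ 0) b d) :
    ∃ S : Finset ι, ((exchange A a b).submatrix ((↑) : S → ι) (↑)).det ≠
      (A.submatrix ((↑) : S → ι) (↑)).det := by
  cases nonempty_fintype ι
  obtain ⟨P, hP⟩ := IsInducedPath.exists_of_reflTransGen h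
  have hcd_ne : c ≠ d := fun h => hcd (h ▸ rfl)
  refine ⟨insert a (insert c P), ?_⟩
  have ha : a ∈ insert a (insert c P) := by simp
  have hb : b ∈ insert a (insert c P) := by simp [hP.start_mem]
  have hc : c ∈ insert a (insert c P) := by simp
  have hd : d ∈ insert a (insert c P) := by simp [hP.end_mem]
  rw [det_submatrix_exchange hA hac hbc hbd hcd_ne, ne_eq, add_eq_left,
    principalPad_of_mem hb ha, principalPad_of_mem ha hb, principalPad_of_mem hc hd,
    principalPad_of_mem hd hc]
  exact mul_ne_zero (mul_ne_zero (sub_ne_zero.mpr hab.symm) (sub_ne_zero.mpr hcd))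
    (coMinor_principalPad_ne_zero hP hac had hbc hpivot)

end Separation

section Cuts

variable {F : Type*} [Field F] {n : ℕ} {A : Matrix (Fin n) (Fin n) F}

theorem rank_block_le_one_iff {S T : Finset (Fin n)} {a c : Fin n} (ha : a ∈ S) (hc : c ∈ T)
    (hpivot : A a c ≠ 0) :
    (block A S T).rank ≤ 1 ↔ ∀ s ∈ S, ∀ t ∈ T, condensation A a c s t = 0 := by
  refine ⟨fun h s hs t ht => ?_, fun h => ?_⟩
  · by_contra hst
    let M : Matrix (Fin 2) (Fin 2) F :=
      (block A S T).submatrix ![⟨a, ha⟩, ⟨s, hs⟩] ![⟨c, hc⟩, ⟨t, ht⟩]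
    have hdet : M.det = condensation A a c s t := by
      rw [det_fin_two, mul_comm (M 0 1)]
      rfl
    have hrank : M.rank = 2 := rank_of_det_ne_zero (hdet.trans_ne hst)
    have := rank_submatrix_le (block A S T) ![⟨a, ha⟩, ⟨s, hs⟩] ![⟨c, hc⟩, ⟨t, ht⟩]
    change M.rank ≤ _ at this
    omega
  · have hblock : block A S T = vecMulVec (fun s : S => A s c / A a c) (fun t : T => A a t) := by
      ext s t
      have := h s s.2 t t.2
      simp only [condensation, of_apply] at this
      simp only [block, submatrix_apply, vecMulVec_apply]
      field_simp
      linear_combination this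
    rw [hblock]
    exact rank_vecMulVec_le _ _

theorem one_le_rank_block {S T : Finset (Fin n)} {a c : Fin n} (ha : a ∈ S) (hc : c ∈ T)
    (hpivot : A a c ≠ 0) : 1 ≤ (block A S T).rank := by
  let M : Matrix (Fin 1) (Fin 1) F := (block A S T).submatrix ![⟨a, ha⟩] ![⟨c, hc⟩]
  have hrank : M.rank = 1 := rank_of_det_ne_zero ((det_fin_one M).trans_ne hpivot)
  exact hrank.ge.trans (rank_submatrix_le (block A S T) ![⟨a, ha⟩] ![⟨c, hc⟩])

theorem mem_of_reflTransGen_of_rank_block_le_one {X : Finset (Fin n)} {a b c d : Fin n}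
    (hX : (block A X Xᶜ).rank ≤ 1) (ha : a ∈ X) (hb : b ∈ X) (hc : c ∈ Xᶜ) (hpivot : A a c ≠ 0)
    (h : Relation.ReflTransGen (fun s t => condensation A a c s t ≠ 0) b d) : d ∈ X := by
  induction h with
  | refl => exact hb
  | @tail s t _ hst hs =>
    by_contra ht
    exact hst ((rank_block_le_one_iff ha hc hpivot).mp hX s hs t (Finset.mem_compl.mpr ht))

omit [Field F] in
theorem IsSymmExcept.block_compl {a b c d : Fin n} (hA : IsSymmExcept A a b c d)
    {X : Finset (Fin n)} (ha : a ∈ X) (hb : b ∈ X) (hc : c ∈ Xᶜ) (hd : d ∈ Xᶜ) :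
    block A Xᶜ X = (block A X Xᶜ)ᵀ := by
  rw [Finset.mem_compl] at hc hd
  ext ⟨t, ht⟩ ⟨s, hs⟩
  rw [Finset.mem_compl] at ht
  refine hA t s (fun h => ?_) fun h => ?_ <;>
    rcases Sym2.eq_iff.mp h with ⟨rfl, rfl⟩ | ⟨rfl, rfl⟩ <;> contradiction

theorem exists_isCut_of_not_reflTransGen {a b c d : Fin n} (hA : IsSymmExcept A a b c d)
    (hab : a ≠ b) (hac : a ≠ c) (had : a ≠ d) (hbc : b ≠ c) (hcd : c ≠ d) (hpivot : A a c ≠ 0)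
    (h : ¬ Relation.ReflTransGen (fun s t => condensation A a c s t ≠ 0) b d) :
    ∃ X : Finset (Fin n), IsCut A X ∧ a ∈ X ∧ b ∈ X ∧ c ∈ Xᶜ ∧ d ∈ Xᶜ := by
  classical
  let r : Fin n → Fin n → Prop := fun s t => condensation A a c s t ≠ 0
  let X : Finset (Fin n) := {t | t = a ∨ Relation.ReflTransGen r b t}
  have mem_X {t : Fin n} : t ∈ X ↔ t = a ∨ Relation.ReflTransGen r b t := by simp [X]
  have ha : a ∈ X := mem_X.mpr (.inl rfl)
  have hb : b ∈ X := mem_X.mpr (.inr .refl)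
  have hc : c ∈ Xᶜ := by
    rw [Finset.mem_compl, mem_X, not_or, Relation.ReflTransGen.cases_tail_iff]
    refine ⟨hac.symm, ?_⟩
    rintro (hcb | ⟨s, -, hsc⟩)
    exacts [hbc hcb.symm, hsc (condensation_pivot_column A a c s)]
  have hd : d ∈ Xᶜ := by
    rw [Finset.mem_compl, mem_X, not_or]
    exact ⟨had.symm, h⟩
  have hrank : (block A X Xᶜ).rank ≤ 1 := by
    refine (rank_block_le_one_iff ha hc hpivot).mpr fun s hs t ht => ?_
    rw [Finset.mem_compl, mem_X, not_or] at ht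
    rcases mem_X.mp hs with rfl | hs
    · exact condensation_pivot_row A s c t
    · exact not_not.mp fun hst => ht.2 (hs.tail hst)
  have hpair_le {x y : Fin n} {Y : Finset (Fin n)} (hxy : x ≠ y) (hx : x ∈ Y) (hy : y ∈ Y) :
      2 ≤ Y.card := Finset.one_lt_card.mpr ⟨x, hx, y, hy, hxy⟩
  have hcard := X.card_add_card_compl
  have := hpair_le hcd hc hd
  rw [Fintype.card_fin] at hcard
  have hrank_compl : (block A Xᶜ X).rank ≤ 1 := by
    rwa [hA.block_compl ha hb hc hd, rank_transpose]
  exact ⟨X, ⟨hpair_le hab ha hb, by omega, hrank, hrank_compl⟩, ha, hb, hc, hd⟩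

theorem pme_exchange_iff {a b c d : Fin n} (hA : IsSymmExcept A a b c d)
    (hac : a ≠ c) (had : a ≠ d) (hbc : b ≠ c) (hbd : b ≠ d) (hpivot : A a c ≠ 0)
    (hab : A a b ≠ A b a) (hcd : A c d ≠ A d c) :
    PME A (exchange A a b) ↔
      ∃ X : Finset (Fin n), IsCut A X ∧ a ∈ X ∧ b ∈ X ∧ c ∈ Xᶜ ∧ d ∈ Xᶜ := by
  have hab_ne : a ≠ b := fun h => hab (h ▸ rfl)
  have hcd_ne : c ≠ d := fun h => hcd (h ▸ rfl)
  constructor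
  · intro h
    refine exists_isCut_of_not_reflTransGen hA hab_ne hac had hbc hcd_ne hpivot fun hreach => ?_
    obtain ⟨S, hS⟩ := exists_det_submatrix_exchange_ne hA hac had hbc hbd hpivot hab hcd hreach
    exact hS (h S).symm
  · rintro ⟨X, ⟨-, -, hX, -⟩, ha, hb, hc, hd⟩ S
    rw [rank_block_le_one_iff ha hc hpivot] at hX
    rw [Finset.mem_compl] at hc hd
    exact (det_submatrix_exchange_of_condensation_eq_zero hA hcd_ne hpivot ha hb hc hd
      fun s _ hs t _ ht => hX s hs t (Finset.mem_compl.mpr ht)).symm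

end Cuts

section Template

variable {F : Type*} [Field F] {n : ℕ} {hn : 4 ≤ n} {A : Matrix (Fin n) (Fin n) F}

theorem two_ne_one : (2 : F) ≠ 1 := by
  simp [← one_add_one_eq_two]

theorem idx_injective (hn : 4 ≤ n) : Function.Injective (idx hn) :=
  Fin.castLE_injective hn

theorem exists_idx_eq (hn : 4 ≤ n) {i : Fin n} (hi : (i : ℕ) < 4) : ∃ k, idx hn k = i :=
  ⟨⟨i, hi⟩, rfl⟩

theorem HasTemplateForm.isSymmExcept (hA : HasTemplateForm hn A) :
    IsSymmExcept A (idx hn 0) (idx hn 1) (idx hn 2) (idx hn 3) := by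
  intro i j h01 h23
  by_cases h : 4 ≤ (i : ℕ) ∨ 4 ≤ (j : ℕ)
  · exact hA.2.2 i j h
  push Not at h
  obtain ⟨p, rfl⟩ := exists_idx_eq hn h.1
  obtain ⟨q, rfl⟩ := exists_idx_eq hn h.2
  simp only [ne_eq, Sym2.eq_iff, (idx_injective hn).eq_iff] at h01 h23
  rw [hA.1, hA.1]
  fin_cases p <;> fin_cases q <;> simp_all [leadingBlock]

theorem HasTemplateForm.pivot_ne_zero (hA : HasTemplateForm hn A) :
    A (idx hn 0) (idx hn 2) ≠ 0 := by
  simp [hA.1, leadingBlock]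

theorem HasTemplateForm.condensation_eq_zero (hA : HasTemplateForm hn A)
    {s t : Fin n} (hs : s ∈ ({idx hn 0, idx hn 1} : Finset (Fin n)))
    (ht : t ∈ ({idx hn 2, idx hn 3} : Finset (Fin n))) :
    condensation A (idx hn 0) (idx hn 2) s t = 0 := by
  simp only [Finset.mem_insert, Finset.mem_singleton] at hs ht
  rcases hs with rfl | rfl <;> rcases ht with rfl | rfl <;>
    simp [condensation, hA.1, leadingBlock]

theorem HasTemplateForm.rank_block_eq_one (hA : HasTemplateForm hn A) :
    (block A {idx hn 0, idx hn 1} {idx hn 2, idx hn 3}).rank = 1 := by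
  refine le_antisymm ?_ (one_le_rank_block (by simp) (by simp) hA.pivot_ne_zero)
  rw [rank_block_le_one_iff (by simp) (by simp) hA.pivot_ne_zero]
  exact fun s hs t ht => hA.condensation_eq_zero hs ht

theorem HasTemplateForm.pmeUpTo_four_swapEntries (hA : HasTemplateForm hn A) :
    PMEUpTo 4 A (swapEntries hn A) := by
  have hne {p q : Fin 4} (h : p ≠ q) : idx hn p ≠ idx hn q := (idx_injective hn).ne h
  intro S hS
  symm
  by_cases hsub : {idx hn 0, idx hn 1, idx hn 2, idx hn 3} ⊆ S
  · have hS_eq : {idx hn 0, idx hn 1, idx hn 2, idx hn 3} = S :=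
      Finset.eq_of_subset_of_card_le hsub (by simpa [(idx_injective hn).eq_iff] using hS)
    refine det_submatrix_exchange_of_condensation_eq_zero hA.isSymmExcept (hne (by decide))
      hA.pivot_ne_zero (X := {idx hn 0, idx hn 1}) (by simp) (by simp)
      (by simp [(idx_injective hn).eq_iff]) (by simp [(idx_injective hn).eq_iff])
      fun s _ hsX t ht htX => hA.condensation_eq_zero hsX ?_
    simp only [← hS_eq, Finset.mem_insert, Finset.mem_singleton] at ht htX ⊢
    tauto
  · exact det_submatrix_exchange_of_not_subset hA.isSymmExcept (hne (by decide))
      (hne (by decide)) (hne (by decide)) (hne (by decide)) hsub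

theorem HasTemplateForm.pme_swapEntries_iff (hA : HasTemplateForm hn A) :
    PME A (swapEntries hn A) ↔
      ∃ X : Finset (Fin n), IsCut A X ∧
        idx hn 0 ∈ X ∧ idx hn 1 ∈ X ∧ idx hn 2 ∈ Xᶜ ∧ idx hn 3 ∈ Xᶜ := by
  have hne {p q : Fin 4} (h : p ≠ q) : idx hn p ≠ idx hn q := (idx_injective hn).ne h
  exact pme_exchange_iff hA.isSymmExcept (hne (by decide)) (hne (by decide)) (hne (by decide))
    (hne (by decide)) hA.pivot_ne_zero (by simp [hA.1, leadingBlock, two_ne_one.symm])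
    (by simp [hA.1, leadingBlock, two_ne_one])

end Template

section ExplicitMatrix

variable {F : Type*} [Field F] {n : ℕ}

theorem explicitMatrix_apply (i j : Fin n) :
    explicitMatrix F n i j =
      if (i : ℕ) = 1 ∧ (j : ℕ) = 0 ∨ (i : ℕ) = 2 ∧ (j : ℕ) = 3 ∨
        (4 ≤ (i : ℕ) ∨ 4 ≤ (j : ℕ)) ∧ ((i : ℕ) + 1 = j ∨ (j : ℕ) + 1 = i ∨
          (i : ℕ) = 0 ∧ (j : ℕ) + 1 = n ∨ (j : ℕ) = 0 ∧ (i : ℕ) + 1 = n) then 2 else 1 := by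
  rw [explicitMatrix, of_apply]
  split_ifs with h
  all_goals first | rfl | (exfalso; omega) | skip
  all_goals
    obtain ⟨i, hi⟩ := i
    obtain ⟨j, hj⟩ := j
    obtain ⟨hi', hj'⟩ := h
    dsimp only at *
    interval_cases i <;> interval_cases j <;> simp_all [leadingBlock]

theorem hasTemplateForm_explicitMatrix (hn : 4 ≤ n) : HasTemplateForm hn (explicitMatrix F n) := by
  refine ⟨fun p q => ?_, fun i => ?_, fun i j h => ?_⟩
  · rw [explicitMatrix, of_apply, dif_pos ⟨p.isLt, q.isLt⟩]
    rfl
  · rw [explicitMatrix_apply, if_neg (by omega)]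
  · rw [explicitMatrix_apply, explicitMatrix_apply]
    exact if_congr (by omega) rfl rfl

theorem isDense_explicitMatrix (h2 : (2 : F) ≠ 0) : IsDense (explicitMatrix F n) := by
  intro i j _
  rw [explicitMatrix_apply]
  split_ifs
  exacts [h2, one_ne_zero]

theorem IsDense.swapEntries {hn : 4 ≤ n} {A : Matrix (Fin n) (Fin n) F} (hA : IsDense A) :
    IsDense (swapEntries hn A) := by
  intro i j hij
  rw [PrincipalMinors.swapEntries, of_apply]
  split_ifs
  exacts [hA j i hij.symm, hA i j hij]

theorem condensation_explicitMatrix (hn : 4 ≤ n) (s t : Fin n) :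
    condensation (explicitMatrix F n) (idx hn 0) (idx hn 2) s t =
      explicitMatrix F n s t - explicitMatrix F n (idx hn 0) t := by
  have hidx : (idx hn 2 : ℕ) = 2 := rfl
  have hcol (i : Fin n) : explicitMatrix F n i (idx hn 2) = 1 := by
    rw [explicitMatrix_apply, if_neg (by omega)]
  simp [condensation, hcol]

theorem condensation_explicitMatrix_eq_zero (hn : 4 ≤ n) {s t m : Fin n}
    (hs : (s : ℕ) < 2 ∨ m < s) (ht : 2 ≤ (t : ℕ)) (htm : t < m) :
    condensation (explicitMatrix F n) (idx hn 0) (idx hn 2) s t = 0 := by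
  have hidx : (idx hn 0 : ℕ) = 0 := rfl
  rw [condensation_explicitMatrix, explicitMatrix_apply, explicitMatrix_apply,
    if_neg (by omega), if_neg (by omega), sub_self]

theorem reflTransGen_condensation_explicitMatrix (hn : 4 ≤ n) (hn5 : 5 ≤ n) :
    Relation.ReflTransGen
      (fun s t => condensation (explicitMatrix F n) (idx hn 0) (idx hn 2) s t ≠ 0)
      (idx hn 1) (idx hn 3) := by
  have hidx (k : Fin 4) : (idx hn k : ℕ) = k := rfl
  have hdescend (i : ℕ) (hi : i + 3 < n) : Relation.ReflTransGen
      (fun s t => condensation (explicitMatrix F n) (idx hn 0) (idx hn 2) s t ≠ 0)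
      ⟨i + 3, hi⟩ (idx hn 3) := by
    induction i with
    | zero => exact .refl
    | succ i ih =>
      refine .head ?_ (ih (by omega))
      rw [condensation_explicitMatrix, explicitMatrix_apply, explicitMatrix_apply,
        if_pos (by dsimp only; omega), if_neg (by simp only [hidx]; grind)]
      exact sub_ne_zero.mpr two_ne_one
  obtain ⟨k, rfl⟩ := Nat.exists_eq_add_of_le hn5
  refine .head ?_ (hdescend (k + 1) (by omega))
  rw [condensation_explicitMatrix, explicitMatrix_apply, explicitMatrix_apply,
    if_neg (by simp only [hidx]; grind), if_pos (by simp only [hidx]; grind)]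
  exact sub_ne_zero.mpr two_ne_one.symm

theorem pmeUpTo_explicitMatrix_swapEntries (hn : 4 ≤ n) :
    PMEUpTo (n - 1) (explicitMatrix F n) (swapEntries hn (explicitMatrix F n)) := by
  have hA : HasTemplateForm hn (explicitMatrix F n) := hasTemplateForm_explicitMatrix hn
  have hne {p q : Fin 4} (h : p ≠ q) : idx hn p ≠ idx hn q := (idx_injective hn).ne h
  have hidx (k : Fin 4) : (idx hn k : ℕ) = k := rfl
  intro S hS
  symm
  by_cases hsub : {idx hn 0, idx hn 1, idx hn 2, idx hn 3} ⊆ S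
  · obtain ⟨m, hm⟩ : ∃ m, m ∉ S := by
      by_contra! hall
      rw [Finset.eq_univ_of_forall hall, Finset.card_fin] at hS
      omega
    have hm4 : 4 ≤ (m : ℕ) := by
      by_contra! hlt
      obtain ⟨k, rfl⟩ := exists_idx_eq hn hlt
      exact hm (hsub (by fin_cases k <;> simp))
    let X : Finset (Fin n) := {s | (s : ℕ) < 2 ∨ m < s}
    have mem_X {s : Fin n} : s ∈ X ↔ (s : ℕ) < 2 ∨ m < s := by simp [X]
    have hidx_mem {k : Fin 4} : idx hn k ∈ X ↔ (k : ℕ) < 2 := by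
      rw [mem_X, Fin.lt_def, hidx]
      omega
    refine det_submatrix_exchange_of_condensation_eq_zero hA.isSymmExcept (hne (by decide))
      hA.pivot_ne_zero (hidx_mem.mpr (by decide)) (hidx_mem.mpr (by decide))
      (mt hidx_mem.mp (by decide)) (mt hidx_mem.mp (by decide)) fun s _ hs t ht htX => ?_
    rw [mem_X, not_or, not_lt, not_lt] at htX
    exact condensation_explicitMatrix_eq_zero hn (mem_X.mp hs) htX.1
      (lt_of_le_of_ne htX.2 fun h => hm (h ▸ ht))
  · exact det_submatrix_exchange_of_not_subset hA.isSymmExcept (hne (by decide))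
      (hne (by decide)) (hne (by decide)) (hne (by decide)) hsub

theorem not_rank_block_explicitMatrix_le_one (hn : 4 ≤ n) (hn5 : 5 ≤ n) {X : Finset (Fin n)}
    (h0 : idx hn 0 ∈ X) (h1 : idx hn 1 ∈ X) (h2 : idx hn 2 ∈ Xᶜ) (h3 : idx hn 3 ∈ Xᶜ) :
    ¬ (block (explicitMatrix F n) X Xᶜ).rank ≤ 1 := fun hX =>
  Finset.mem_compl.mp h3 (mem_of_reflTransGen_of_rank_block_le_one hX h0 h1 h2
    (hasTemplateForm_explicitMatrix hn).pivot_ne_zero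
    (reflTransGen_condensation_explicitMatrix hn hn5))

theorem not_hasRankOneExtension_explicitMatrix (hn5 : 5 ≤ n) :
    ¬ HasRankOneExtension (explicitMatrix F n) := by
  have hn : 4 ≤ n := by omega
  have hne {p q : Fin 4} (h : p ≠ q) : idx hn p ≠ idx hn q := (idx_injective hn).ne h
  intro h
  obtain ⟨X, h0, h1, h2, h3, hX⟩ := h (idx hn 0) (idx hn 1) (idx hn 2) (idx hn 3)
    (hne (by decide)) (hne (by decide)) (hne (by decide)) (hne (by decide)) (hne (by decide))
    (hne (by decide)) (hasTemplateForm_explicitMatrix hn).rank_block_eq_one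
  exact not_rank_block_explicitMatrix_le_one hn hn5 h0 h1 h2 h3 hX.le

theorem not_pme_explicitMatrix_swapEntries (hn : 4 ≤ n) (hn5 : 5 ≤ n) :
    ¬ PME (explicitMatrix F n) (swapEntries hn (explicitMatrix F n)) := by
  rw [(hasTemplateForm_explicitMatrix hn).pme_swapEntries_iff]
  rintro ⟨X, ⟨-, -, hX, -⟩, h0, h1, h2, h3⟩
  exact not_rank_block_explicitMatrix_le_one hn hn5 h0 h1 h2 h3 hX

end ExplicitMatrix

end PrincipalMinors

theorem mainTheorem10_general (F : Type*) [Field F] (n : ℕ) (hn : 4 ≤ n) :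
    (∀ A B : Matrix (Fin n) (Fin n) F, HasTemplateForm hn A → B = swapEntries hn A →
      PMEUpTo 4 A B ∧
      (PME A B ↔ ∃ X : Finset (Fin n), IsCut A X ∧
        idx hn 0 ∈ X ∧ idx hn 1 ∈ X ∧ idx hn 2 ∈ Xᶜ ∧ idx hn 3 ∈ Xᶜ)) ∧
    (5 ≤ n → ∀ A B : Matrix (Fin n) (Fin n) F,
      A = explicitMatrix F n → B = swapEntries hn A →
      ((2 : F) ≠ 0 → IsDense A ∧ IsDense B) ∧ HasTemplateForm hn A ∧
      (block A {idx hn 0, idx hn 1} {idx hn 2, idx hn 3}).rank = 1 ∧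
      (¬ ∃ X : Finset (Fin n),
        idx hn 0 ∈ X ∧ idx hn 1 ∈ X ∧ idx hn 2 ∈ Xᶜ ∧ idx hn 3 ∈ Xᶜ ∧
          (block A X Xᶜ).rank ≤ 1) ∧
      ¬ HasRankOneExtension A ∧ PMEUpTo (n - 1) A B ∧ ¬ PME A B) := by
  refine ⟨?_, ?_⟩
  · rintro A _ hA rfl
    exact ⟨hA.pmeUpTo_four_swapEntries, hA.pme_swapEntries_iff⟩
  · rintro hn5 _ _ rfl rfl
    have hA : HasTemplateForm hn (explicitMatrix F n) := hasTemplateForm_explicitMatrix hn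
    exact ⟨fun h2 => ⟨isDense_explicitMatrix h2, (isDense_explicitMatrix h2).swapEntries⟩, hA,
      hA.rank_block_eq_one,
      fun ⟨_, h0, h1, h2, h3, hX⟩ => not_rank_block_explicitMatrix_le_one hn hn5 h0 h1 h2 h3 hX,
      not_hasRankOneExtension_explicitMatrix hn5, pmeUpTo_explicitMatrix_swapEntries hn,
      not_pme_explicitMatrix_swapEntries hn hn5⟩

theorem mainTheorem10 (F : Type*) [Field F] (n : ℕ) (hn : 4 ≤ n) :
    -- the claim, for every matrix of the given form
    (∀ A B : Matrix (Fin n) (Fin n) F,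
      IsDense A → HasTemplateForm hn A →
      (¬ ∃ X : Finset (Fin n), IsCut A X ∧
        idx hn 0 ∈ X ∧ idx hn 1 ∈ X ∧ idx hn 2 ∈ Xᶜ ∧ idx hn 3 ∈ Xᶜ) →
      B = swapEntries hn A →
      PMEUpTo 4 A B ∧ ¬ PME A B) ∧
    -- the explicit pair of matrices
    (5 ≤ n → (2 : F) ≠ 0 →
      ∀ A B : Matrix (Fin n) (Fin n) F,
      A = explicitMatrix F n → B = swapEntries hn A →
      IsDense A ∧ IsDense B ∧ HasTemplateForm hn A ∧
      (block A {idx hn 0, idx hn 1} {idx hn 2, idx hn 3}).rank = 1 ∧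
      (¬ ∃ X : Finset (Fin n),
        idx hn 0 ∈ X ∧ idx hn 1 ∈ X ∧ idx hn 2 ∈ Xᶜ ∧ idx hn 3 ∈ Xᶜ ∧
          (block A X Xᶜ).rank = 1) ∧
      ¬ HasRankOneExtension A ∧
      (¬ ∃ X : Finset (Fin n), IsCut A X ∧
        idx hn 0 ∈ X ∧ idx hn 1 ∈ X ∧ idx hn 2 ∈ Xᶜ ∧ idx hn 3 ∈ Xᶜ) ∧
      PMEUpTo (n - 1) A B ∧ PMEUpTo 4 A B ∧ ¬ PME A B) := by
  obtain ⟨htemplate, hexplicit⟩ := mainTheorem10_general F n hn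
  refine ⟨fun A B _ hA hcut hB => ?_, fun hn5 h2 A B hA hB => ?_⟩
  · exact (htemplate A B hA hB).imp_right fun hiff => mt hiff.mp hcut
  · obtain ⟨hdense, hform, hrank, hsep, hext, hupTo, hpme⟩ := hexplicit hn5 A B hA hB
    exact ⟨(hdense h2).1, (hdense h2).2, hform, hrank,
      fun ⟨X, h0, h1, h2, h3, hX⟩ => hsep ⟨X, h0, h1, h2, h3, hX.le⟩, hext,
      fun ⟨X, ⟨_, _, hX, _⟩, h0, h1, h2, h3⟩ => hsep ⟨X, h0, h1, h2, h3, hX⟩,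
      hupTo, (htemplate A B hform hB).1, hpme⟩
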